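/- Let $M$ be a von Neumann algebra on a separable Hilbert space with a faithful normal semifinite trace $\tau$. Let $M_*$ be the space of $\sigma$-weakly continuous functionals on $M$; it is identified with $L^1(M,\tau)$ through $X \leftrightarrow \tau(X\,\cdot)$. Let $G$ be a locally compact second countable Hausdorff semigroup with a $\sigma$-finite Borel measure $m$ such that $m(uB)=m(B)=m(Bu)$ for all $u\in G$ and Borel sets $B$, and let $(K_n)_{n\in\mathbb N}$ be a Følner sequence: the $K_n$ are measurable, $0<m(K_n)<\infty$, and $m(K_n\,\Delta\,K_ng)/m(K_n)\to0$ and $m(K_n\,\Delta\,gK_n)/m(K_n)\to0$ for all $g\in G$. Let $(M,G,\alpha)$ be a non-commutative dynamical system: $\alpha$ is an action or an anti-action of $G$ on $M$ by normal positive contractions $\alpha_g$ with $\alpha_g(1)\le 1$, and $g\mapsto\alpha_g(x)$ is weak* continuous for every $x\in M$. Let $\alpha_g^*:L^1(M,\tau)\to L^1(M,\tau)$ be given by $\tau(\alpha_g^*(X)y)=\tau(X\alpha_g(y))$ for $y\in M$. The support $s(X)$ of $X\in L^1(M,\tau)$ is the smallest projection $p\in M$ with $pX=X=Xp$; likewise,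 the support of a positive $x\in M$ is the smallest projection $p\in M$ with $px=x$, and the support of $\rho\in M_*$ is that of the corresponding element of $L^1(M,\tau)$. Let $e_1,e_2\in M$ be the projections of the Neveu decomposition: $e_1+e_2=1$; $e_1$ is the support of a $G$-invariant positive normal functional $\rho$ on $M$ (so either $e_1=0$, or $e_1$ is the support of a $G$-invariant normal state); and $e_2$ is the support of a weakly wandering operator, i.e. of a positive $x_0\in M$ such that the weak* integrals $A_n(x_0)=\frac1{m(K_n)}\int_{K_n}\alpha_g(x_0)\,dm(g)$ satisfy $\|A_n(x_0)\|\to0$. Then $$\alpha_g(e_2)\le e_2\quad\text{and}\quad s\big(\alpha_g^*(e_1Xe_1)\big)\le e_1\qquad\text{for all }X\in L^1(M,\tau),\ g\in G.$$ If moreover every $\alpha_g^*$ is a Lamperti operator on $L^1(M,\tau)$, i.e. $\alpha_g^*(p)\,\alpha_g^*(q)=0$ for all projections $p,q\in M$ with $\tau(p),\tau(q)<\infty$ and $pq=0$, then also $\alpha_g(e_1)\le e_1$ for all $g\in G$. -/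

import Mathlib

open Filter Topology MeasureTheory
open scoped ENNReal NNReal ComplexOrder

/-- The von Neumann algebra `M ⊆ B(H)` as a type. It carries the operator norm, the adjoint and the
order of operators (`x ≤ y` iff `y - x` is a positive operator). -/
abbrev VNElem {H : Type*} [NormedAddCommGroup H] [InnerProductSpace ℂ H] [CompleteSpace H]
    (M : VonNeumannAlgebra H) : Type _ :=
  M.toStarSubalgebra

section Functionals

variable {H : Type*} [NormedAddCommGroup H] [InnerProductSpace ℂ H] [CompleteSpace H]
  {M : VonNeumannAlgebra H}

/-- `φ ∈ M_*`: the functional `φ` on `M` is `σ`-weakly continuous, that is,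
`φ(x) = ∑ ⟨x ξₙ, ηₙ⟩` with `∑ ‖ξₙ‖² < ∞` and `∑ ‖ηₙ‖² < ∞`. (Mathlib's inner product is conjugate
linear in the first variable.) The space `M_*` of these functionals, with the norm of the dual of
`M`, is identified with `L¹(M, τ)` by `X ↦ τ(X ·)`. -/
def IsNormalFunctional (φ : StrongDual ℂ (VNElem M)) : Prop :=
  ∃ ξ η : ℕ → H, (Summable fun n => ‖ξ n‖ ^ 2) ∧ (Summable fun n => ‖η n‖ ^ 2) ∧
    ∀ x : VNElem M, φ x = ∑' n, inner ℂ (η n) ((x : H →L[ℂ] H) (ξ n))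

/-- Positivity of a functional: `φ(x* x) ≥ 0` for all `x`. -/
def IsPositiveFunctional (φ : StrongDual ℂ (VNElem M)) : Prop :=
  ∀ x : VNElem M, 0 ≤ φ (star x * x)

/-- `s` is the support of the self-adjoint operator `x ∈ M`: the smallest projection of `M` with
`s x = x`. -/
def IsOperatorSupport (x s : VNElem M) : Prop :=
  IsLeast {p : VNElem M | IsStarProjection p ∧ p * x = x} s

/-- `s` is the support of `φ ∈ M_*`: the smallest projection `p` of `M` with
`φ(x p) = φ(x) = φ(p x)` for all `x ∈ M`. For `φ = τ(X ·)` with `X ∈ L¹(M, τ)` these equations say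
`p X = X = X p`, so `s` is the support of `X`. For a positive normal `φ` they say `φ(1 - p) = 0`, so
`1 - s` is the largest projection on which `φ` vanishes. -/
def IsFunctionalSupport (φ : StrongDual ℂ (VNElem M)) (s : VNElem M) : Prop :=
  IsLeast {p : VNElem M | IsStarProjection p ∧ ∀ x, φ (x * p) = φ x ∧ φ (p * x) = φ x} s

/-- For `φ = τ(X ·)`, this is the functional `τ(e X f ·)`, i.e. `x ↦ φ(f x e)`. -/
noncomputable def compress (e f : VNElem M) (φ : StrongDual ℂ (VNElem M)) :
    StrongDual ℂ (VNElem M) :=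
  φ.comp ((ContinuousLinearMap.mul ℂ (VNElem M) f).comp
    ((ContinuousLinearMap.mul ℂ (VNElem M)).flip e))

/-- The dual map `T^*` of `T : M → M`, `T^*(φ) = φ ∘ T`. If `T` is normal, then `T^*` maps `M_*` to
itself. -/
noncomputable def dualMap (T : VNElem M →L[ℂ] VNElem M) :
    StrongDual ℂ (VNElem M) →ₗ[ℂ] StrongDual ℂ (VNElem M) where
  toFun φ := φ.comp T
  map_add' _ _ := rfl
  map_smul' _ _ := rfl

/-- For positive `A, B ∈ L¹(M, τ)` with `φ = τ(A ·)` and `ψ = τ(B ·)`, this says `A B = 0`: the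
supports of `A` and `B` are orthogonal. -/
def HaveZeroProduct (φ ψ : StrongDual ℂ (VNElem M)) : Prop :=
  ∃ s t : VNElem M, IsFunctionalSupport φ s ∧ IsFunctionalSupport ψ t ∧ s * t = 0

end Functionals

section Trace

variable {H : Type*} [NormedAddCommGroup H] [InnerProductSpace ℂ H] [CompleteSpace H]

/-- A faithful normal semifinite trace `τ : M₊ → [0, ∞]`. Only the values at positive elements
matter. -/
structure FNSTrace (M : VonNeumannAlgebra H) where
  /-- the value of the trace (meaningful at positive elements) -/
  toFun : VNElem M → ℝ≥0∞
  map_add : ∀ x y : VNElem M, 0 ≤ x → 0 ≤ y → toFun (x + y) = toFun x + toFun y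
  map_smul : ∀ (c : ℝ≥0) (x : VNElem M), 0 ≤ x → toFun (((c : ℝ) : ℂ) • x) = c * toFun x
  tracial : ∀ x : VNElem M, toFun (star x * x) = toFun (x * star x)
  faithful : ∀ x : VNElem M, 0 ≤ x → toFun x = 0 → x = 0
  normal : ∀ (D : Set (VNElem M)) (x : VNElem M), D.Nonempty → DirectedOn (· ≤ ·) D →
    (∀ y ∈ D, 0 ≤ y) → IsLUB D x → toFun x = ⨆ y ∈ D, toFun y
  semifinite : ∀ x : VNElem M, 0 ≤ x → x ≠ 0 →
    ∃ y : VNElem M, 0 ≤ y ∧ y ≤ x ∧ y ≠ 0 ∧ toFun y < ∞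

variable {M : VonNeumannAlgebra H}

/-- `φ` is the functional `τ(p ·)` of a projection `p` with `τ(p) < ∞`: `φ(x) = τ(p x p)` for all
`x ≥ 0` (hence for all `x` by linearity). -/
def IsTraceFunctional (τ : FNSTrace M) (p : VNElem M) (φ : StrongDual ℂ (VNElem M)) : Prop :=
  ∀ x : VNElem M, 0 ≤ x → φ x = (((τ.toFun (p * x * p)).toReal : ℝ) : ℂ)

/-- `γ` is Lamperti: `γ(p) γ(q) = 0` for all projections `p, q ∈ L¹(M, τ)` (i.e. of finite trace)
with `p q = 0`. -/
def IsLamperti (τ : FNSTrace M)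
    (γ : StrongDual ℂ (VNElem M) →ₗ[ℂ] StrongDual ℂ (VNElem M)) : Prop :=
  ∀ p q : VNElem M, IsStarProjection p → IsStarProjection q →
    τ.toFun p < ∞ → τ.toFun q < ∞ → p * q = 0 →
    ∀ φ ψ : StrongDual ℂ (VNElem M), IsTraceFunctional τ p φ → IsTraceFunctional τ q ψ →
      HaveZeroProduct (γ φ) (γ ψ)

/-- The class of positive Lamperti contractions of `L¹(M, τ) = M_*`. -/
def lampertiClass (τ : FNSTrace M) :
    Set (StrongDual ℂ (VNElem M) →ₗ[ℂ] StrongDual ℂ (VNElem M)) :=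
  {γ | (∀ φ, IsNormalFunctional φ → IsNormalFunctional (γ φ)) ∧
    (∀ φ, IsNormalFunctional φ → IsPositiveFunctional φ → IsPositiveFunctional (γ φ)) ∧
    (∀ φ, IsNormalFunctional φ → ‖γ φ‖ ≤ ‖φ‖) ∧
    IsLamperti τ γ}

end Trace

section Amenable

variable {G : Type*} [Semigroup G] [MeasurableSpace G]

/-- Invariance of a measure on a semigroup: `m(uB) = m(B) = m(Bu)` for Borel sets `B`. -/
def IsTwoSidedInvariant (m : Measure G) : Prop :=
  ∀ (u : G) (B : Set G), MeasurableSet B →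
    m ((fun h => u * h) '' B) = m B ∧ m ((fun h => h * u) '' B) = m B

/-- A two-sided Følner sequence of measurable sets. -/
structure IsFolnerSequence (m : Measure G) (K : ℕ → Set G) : Prop where
  measurableSet : ∀ n, MeasurableSet (K n)
  measure_pos : ∀ n, 0 < m (K n)
  measure_lt_top : ∀ n, m (K n) < ∞
  right : ∀ g : G,
    Tendsto (fun n => m (symmDiff (K n) ((fun h => h * g) '' K n)) / m (K n)) atTop (𝓝 0)
  left : ∀ g : G,
    Tendsto (fun n => m (symmDiff (K n) ((fun h => g * h) '' K n)) / m (K n)) atTop (𝓝 0)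

end Amenable

section Dynamics

variable {H : Type*} [NormedAddCommGroup H] [InnerProductSpace ℂ H] [CompleteSpace H]
  {M : VonNeumannAlgebra H} {G : Type*} [Semigroup G]

/-- A non-commutative dynamical system `(M, G, α)`: an action or anti-action of `G` on `M` by
normal positive contractions with `α_g(1) ≤ 1`, such that `g ↦ α_g(x)` is weak* continuous. -/
structure IsNCDynamicalSystem [TopologicalSpace G] (α : G → VNElem M →L[ℂ] VNElem M) : Prop where
  action_or_antiaction :
    (∀ g h, α (g * h) = (α g).comp (α h)) ∨ (∀ g h, α (g * h) = (α h).comp (α g))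
  continuous : ∀ (x : VNElem M) (φ : StrongDual ℂ (VNElem M)), IsNormalFunctional φ →
    Continuous fun g => φ (α g x)
  contraction : ∀ g, ‖α g‖ ≤ 1
  positive : ∀ g (x : VNElem M), 0 ≤ x → 0 ≤ α g x
  map_one_le : ∀ g, α g 1 ≤ 1
  normal : ∀ g (φ : StrongDual ℂ (VNElem M)), IsNormalFunctional φ →
    IsNormalFunctional (φ.comp (α g))

/-- `a = (1 / m(K)) ∫_K α_g(x) dm(g)` as a weak* integral. -/
def IsAverage [MeasurableSpace G] (m : Measure G) (K : Set G) (α : G → VNElem M →L[ℂ] VNElem M)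
    (x a : VNElem M) : Prop :=
  ∀ φ : StrongDual ℂ (VNElem M), IsNormalFunctional φ →
    φ a = ((m.real K : ℝ) : ℂ)⁻¹ * ∫ g in K, φ (α g x) ∂m

/-- `x ∈ M₊` is weakly wandering: its averages `A_n(x)` over the sets `K n` tend to `0` in norm. -/
def IsWeaklyWandering [MeasurableSpace G] (m : Measure G) (K : ℕ → Set G)
    (α : G → VNElem M →L[ℂ] VNElem M) (x : VNElem M) : Prop :=
  0 ≤ x ∧ ∃ A : ℕ → VNElem M, (∀ n, IsAverage m (K n) α x (A n)) ∧
    Tendsto (fun n => ‖A n‖) atTop (𝓝 0)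

/-- `e₁, e₂` are the projections of the Neveu decomposition of `(M, G, α)`: `e₁ + e₂ = 1`, `e₁` is
the support of a `G`-invariant positive normal functional (equivalently, `e₁ = 0` or `e₁` is the
support of a `G`-invariant normal state), and `e₂` is the support of a weakly wandering operator. -/
structure IsNeveuDecomposition [MeasurableSpace G] (m : Measure G) (K : ℕ → Set G)
    (α : G → VNElem M →L[ℂ] VNElem M) (e₁ e₂ : VNElem M) : Prop where
  add_eq_one : e₁ + e₂ = 1
  exists_invariant : ∃ ρ : StrongDual ℂ (VNElem M), IsNormalFunctional ρ ∧
    IsPositiveFunctional ρ ∧ (∀ g x, ρ (α g x) = ρ x) ∧ IsFunctionalSupport ρ e₁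
  exists_wandering : ∃ x₀ : VNElem M, IsWeaklyWandering m K α x₀ ∧ IsOperatorSupport x₀ e₂

end Dynamics

/-!
Everything rests on one order argument: if a positive normal functional with support `e` vanishes
at `a ≥ 0`, then `a * e = 0`. Indeed its null elements form an algebra stable under bounded strong
limits, and with `a` it contains the range projection of `a`: for a small positive multiple `c` of
`a` the Cesàro means of the powers of `1 - c` converge strongly to the projection onto `ker a`, by
the mean ergodic theorem, and one minus each of them is a null element.

Let `ρ` be invariant under the positive map `T`, with support `e`. Since `ρ (1 - e) = 0`, also
`ρ (T (1 - e)) = 0`, so `T (1 - e) * e = 0`; this gives `T (1 - e) ≤ 1 - e`, and, as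
`y ↦ e * T y * e` kills the positive element `1 - e`, it kills all multiples of it, so that the
functional `y ↦ X (e * T y * e)` is supported below `e`.

For the Lamperti part let `q ≤ 1 - e` be a projection of finite trace and `t` the support of
`T_* q`, `T_*` being the map that `T` induces on `L¹`. For finite `p ≤ e` the functional `T_* p`
is disjoint from `T_* q`, hence vanishes at `t`, that is `p * T t * p = 0`. By semifiniteness
`e * T t * e = 0`, so `ρ t = ρ (T t) = 0` and `t * e = 0`. Hence `T_* q` vanishes at `e`, that is
`q * T e * q = 0`; semifiniteness again gives `T e * (1 - e) = 0`.
-/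

theorem mul_eq_zero_comm_of_isSelfAdjoint {R : Type*} [NonUnitalSemiring R] [StarRing R] {a b : R}
    (ha : IsSelfAdjoint a) (hb : IsSelfAdjoint b) : a * b = 0 ↔ b * a = 0 := by
  rw [← star_eq_zero, star_mul, ha.star_eq, hb.star_eq]

theorem eq_zero_of_forall_smul_le {E : Type*} [AddCommGroup E] [PartialOrder E]
    [IsOrderedAddMonoid E] [Module ℝ E] [PosSMulMono ℝ E] [TopologicalSpace E] [ContinuousSMul ℝ E]
    [ClosedIciTopology E] {c d : E} (h : ∀ t : ℝ, t • c ≤ d) : c = 0 := by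
  have nonpos : ∀ {c : E}, (∀ t : ℝ, t • c ≤ d) → c ≤ 0 := fun {c} hc => by
    have hlim : Tendsto (fun t : ℝ => t⁻¹ • d) atTop (𝓝 ((0 : ℝ) • d)) :=
      tendsto_inv_atTop_zero.smul_const d
    rw [zero_smul] at hlim
    refine ge_of_tendsto hlim ((eventually_gt_atTop 0).mono fun t ht => ?_)
    simpa only [inv_smul_smul₀ ht.ne'] using smul_le_smul_of_nonneg_left (hc t) (inv_pos.2 ht).le
  refine le_antisymm (nonpos h) (neg_nonpos.1 (nonpos fun t => ?_))
  rw [smul_neg, ← neg_smul]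
  exact h (-t)

section CStarAlgebra

open scoped ComplexStarModule

variable {A : Type*} [CStarAlgebra A] [PartialOrder A] [StarOrderedRing A] {a b c e : A}

theorem star_mul_mul_eq_zero_iff (ha : 0 ≤ a) : star c * a * c = 0 ↔ a * c = 0 := by
  refine ⟨fun h => ?_, fun h => by rw [mul_assoc, h, mul_zero]⟩
  obtain ⟨y, rfl⟩ := CStarAlgebra.nonneg_iff_eq_star_mul_self.1 ha
  have hyc : y * c = 0 := by
    rw [← CStarRing.star_mul_self_eq_zero_iff, star_mul, ← h]
    simp only [mul_assoc]
  rw [mul_assoc, hyc, mul_zero]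

theorem mul_eq_zero_of_nonneg_of_le (ha : 0 ≤ a) (hab : a ≤ b) (h : b * c = 0) : a * c = 0 := by
  refine (star_mul_mul_eq_zero_iff ha).1 (le_antisymm ?_ (star_left_conjugate_nonneg ha c))
  calc star c * a * c ≤ star c * b * c := star_left_conjugate_le_conjugate hab c
    _ = 0 := by rw [mul_assoc, h, mul_zero]

theorem le_one_sub_of_mul_eq_zero (he : IsStarProjection e) (ha : IsSelfAdjoint a) (ha1 : a ≤ 1)
    (h : a * e = 0) : a ≤ 1 - e := by
  have h' : e * a = 0 := (mul_eq_zero_comm_of_isSelfAdjoint ha he.isSelfAdjoint).1 h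
  calc a = (1 - e) * a * (1 - e) := by
        rw [sub_mul, h', mul_sub, one_mul, sub_zero, mul_one, h, sub_zero]
    _ ≤ (1 - e) * 1 * (1 - e) := he.one_sub.isSelfAdjoint.conjugate_le_conjugate ha1
    _ = 1 - e := by rw [mul_one, he.one_sub.isIdempotentElem.eq]

theorem norm_one_sub_le_one (ha : 0 ≤ a) (ha1 : a ≤ 1) : ‖1 - a‖ ≤ 1 :=
  (CStarAlgebra.norm_le_one_iff_of_nonneg _ (sub_nonneg.2 ha1)).2 (sub_le_self 1 ha)

theorem inv_norm_add_one_smul_le_one (ha : 0 ≤ a) : (‖a‖ + 1)⁻¹ • a ≤ 1 := by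
  rw [← CStarAlgebra.norm_le_one_iff_of_nonneg _ (by positivity), norm_smul, norm_inv,
    Real.norm_of_nonneg (by positivity), inv_mul_le_one₀ (by positivity)]
  exact (lt_add_one _).le

variable {B : Type*} [CStarAlgebra B] [PartialOrder B] [StarOrderedRing B]

theorem map_star_mul_add_star_mul_eq_zero (f : A →ₚ[ℂ] B) (h : f (star a * a) = 0) (x : A) :
    f (star x * a + star a * x) = 0 := by
  refine eq_zero_of_forall_smul_le (d := f (star x * x)) fun t => ?_
  have hexp : star (x - (t : ℂ) • a) * (x - (t : ℂ) • a) = star x * x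
      - (t : ℂ) • (star x * a + star a * x) + ((t : ℂ) * t) • (star a * a) := by
    rw [star_sub, star_smul, Complex.star_def, Complex.conj_ofReal, mul_sub, sub_mul, sub_mul,
      smul_mul_assoc, smul_mul_smul_comm, mul_smul_comm, smul_add]
    abel
  have hnonneg := f.map_nonneg (star_mul_self_nonneg (x - (t : ℂ) • a))
  rw [hexp, map_add, map_sub, map_smul, map_smul, h, smul_zero, add_zero] at hnonneg
  rw [← Complex.coe_smul]
  exact sub_nonneg.1 hnonneg

theorem map_mul_eq_zero_of_map_eq_zero (f : A →ₚ[ℂ] B) (ha : 0 ≤ a) (h : f a = 0) (x : A) :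
    f (x * a) = 0 ∧ f (a * x) = 0 := by
  obtain ⟨y, rfl⟩ := CStarAlgebra.nonneg_iff_eq_star_mul_self.1 ha
  have key : ∀ z, f (star z * y) = 0 ∧ f (star y * z) = 0 := fun z => by
    have hre := map_star_mul_add_star_mul_eq_zero f h z
    have him := map_star_mul_add_star_mul_eq_zero f h (Complex.I • z)
    rw [star_smul, smul_mul_assoc, mul_smul_comm, Complex.star_def, Complex.conj_I, neg_smul,
      neg_add_eq_sub, ← smul_sub, map_smul, smul_eq_zero_iff_right Complex.I_ne_zero, map_sub,
      sub_eq_zero] at him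
    rw [map_add, him, ← two_smul ℂ, smul_eq_zero_iff_right two_ne_zero] at hre
    exact ⟨hre, him.trans hre⟩
  constructor
  · simpa only [star_mul, star_star, mul_assoc] using (key (y * star x)).1
  · simpa only [mul_assoc] using (key (y * x)).2

/-- The extension of a function on the positive cone to the self-adjoint part by `a ↦ f a⁺ - f a⁻`,
composed with the real part; it turns the trace, finite on a corner `p M p`, into a functional. -/
noncomputable def coneExtension (f : A → ℝ) (x : A) : ℝ :=
  f ((ℜ x : A)⁺) - f ((ℜ x : A)⁻)

theorem coneExtension_eq_sub {f : A → ℝ} (hadd : ∀ x y, 0 ≤ x → 0 ≤ y → f (x + y) = f x + f y)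
    {x : A} (ha : 0 ≤ a) (hb : 0 ≤ b) (hx : (ℜ x : A) = a - b) :
    coneExtension f x = f a - f b := by
  have hdecomp : (ℜ x : A)⁺ - (ℜ x : A)⁻ = a - b :=
    (CFC.posPart_sub_negPart _ (ℜ x).2).trans hx
  have h := congrArg f (sub_eq_sub_iff_add_eq_add.1 hdecomp)
  rw [hadd _ _ (CFC.posPart_nonneg _) hb, hadd _ _ ha (CFC.negPart_nonneg _)] at h
  rw [coneExtension]
  linarith

theorem coneExtension_add {f : A → ℝ} (hadd : ∀ x y, 0 ≤ x → 0 ≤ y → f (x + y) = f x + f y)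
    (x y : A) : coneExtension f (x + y) = coneExtension f x + coneExtension f y := by
  have hx := CFC.posPart_sub_negPart (ℜ x : A) (ℜ x).2
  have hy := CFC.posPart_sub_negPart (ℜ y : A) (ℜ y).2
  have hpos : ∀ a : A, 0 ≤ a⁺ := CFC.posPart_nonneg
  have hneg : ∀ a : A, 0 ≤ a⁻ := CFC.negPart_nonneg
  rw [coneExtension_eq_sub hadd (a := (ℜ x : A)⁺ + (ℜ y : A)⁺) (b := (ℜ x : A)⁻ + (ℜ y : A)⁻)
    (add_nonneg (hpos _) (hpos _)) (add_nonneg (hneg _) (hneg _)), hadd _ _ (hpos _) (hpos _),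
    hadd _ _ (hneg _) (hneg _), coneExtension, coneExtension]
  · ring
  · rw [add_sub_add_comm, hx, hy, map_add, AddSubgroup.coe_add]

theorem coneExtension_smul {f : A → ℝ} (hadd : ∀ x y, 0 ≤ x → 0 ≤ y → f (x + y) = f x + f y)
    (hsmul : ∀ (c : ℝ) x, 0 ≤ c → 0 ≤ x → f (c • x) = c * f x) (c : ℝ) (x : A) :
    coneExtension f (c • x) = c * coneExtension f x := by
  have hx := CFC.posPart_sub_negPart (ℜ x : A) (ℜ x).2
  have hpos := CFC.posPart_nonneg (ℜ x : A)
  have hneg := CFC.negPart_nonneg (ℜ x : A)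
  obtain hc | hc := le_total 0 c
  · rw [coneExtension_eq_sub hadd (smul_nonneg hc hpos) (smul_nonneg hc hneg), hsmul c _ hc hpos,
      hsmul c _ hc hneg, coneExtension]
    · ring
    · rw [← smul_sub, hx, map_smul, selfAdjoint.val_smul]
  · have hc' := neg_nonneg.2 hc
    rw [coneExtension_eq_sub hadd (smul_nonneg hc' hneg) (smul_nonneg hc' hpos), hsmul _ _ hc' hpos,
      hsmul _ _ hc' hneg, coneExtension]
    · ring
    · rw [← smul_sub, neg_smul, ← smul_neg, neg_sub, hx, map_smul, selfAdjoint.val_smul]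

theorem exists_positiveLinearMap_of_additive {f : A → ℝ} (hf : ∀ x, 0 ≤ x → 0 ≤ f x)
    (hadd : ∀ x y, 0 ≤ x → 0 ≤ y → f (x + y) = f x + f y)
    (hsmul : ∀ (c : ℝ) x, 0 ≤ c → 0 ≤ x → f (c • x) = c * f x) :
    ∃ φ : A →ₚ[ℂ] ℂ, ∀ x, 0 ≤ x → φ x = f x := by
  let L : Module.Dual ℝ A :=
    { toFun := coneExtension f
      map_add' := coneExtension_add hadd
      map_smul' := coneExtension_smul hadd hsmul }
  have f_zero : f 0 = 0 := by simpa using hadd 0 0 le_rfl le_rfl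
  have hL : ∀ x, 0 ≤ x → L.extendRCLike (𝕜 := ℂ) x = f x := by
    intro x hx
    have hre : L x = f x := by
      rw [← sub_zero (f x), ← f_zero]
      refine coneExtension_eq_sub hadd hx le_rfl ?_
      rw [sub_zero, (IsSelfAdjoint.of_nonneg hx).coe_realPart]
    have him : L (Complex.I • x) = 0 := by
      rw [← sub_self (f 0)]
      refine coneExtension_eq_sub hadd le_rfl le_rfl ?_
      rw [realPart_I_smul, (IsSelfAdjoint.of_nonneg hx).imaginaryPart, neg_zero, sub_zero]
      rfl
    rw [Module.Dual.extendRCLike_apply, RCLike.I_to_complex, hre, him]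
    simp
  refine ⟨.mk₀ (L.extendRCLike (𝕜 := ℂ)) fun x hx => ?_, hL⟩
  rw [hL x hx]
  exact_mod_cast hf x hx

end CStarAlgebra

namespace VNElem

variable {H : Type*} [NormedAddCommGroup H] [InnerProductSpace ℂ H] [CompleteSpace H]
  {M : VonNeumannAlgebra H}

theorem mem_iff_forall_commute {x : H →L[ℂ] H} :
    x ∈ M.toStarSubalgebra ↔ ∀ y ∈ M.commutant, Commute x y := by
  change x ∈ M ↔ _
  rw [← M.commutant_commutant, VonNeumannAlgebra.mem_commutant_iff, M.commutant_commutant]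
  exact forall₂_congr fun _ _ => eq_comm

theorem mem_of_tendsto_apply {ι : Type*} {l : Filter ι} [l.NeBot] {T : ι → VNElem M}
    {S : H →L[ℂ] H} (h : ∀ v, Tendsto (fun i => (T i : H →L[ℂ] H) v) l (𝓝 (S v))) :
    S ∈ M.toStarSubalgebra := by
  refine mem_iff_forall_commute.2 fun y hy => ContinuousLinearMap.ext fun v => ?_
  refine tendsto_nhds_unique (h (y v)) (((y.continuous.tendsto _).comp (h v)).congr fun i => ?_)
  exact (DFunLike.congr_fun (mem_iff_forall_commute.1 (T i).2 y hy).eq v).symm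

scoped instance isClosed : IsClosed (M.toStarSubalgebra : Set (H →L[ℂ] H)) :=
  IsSeqClosed.isClosed fun x _ hx h =>
    mem_of_tendsto_apply (T := fun n => ⟨x n, hx n⟩) fun v =>
      ((continuous_eval_const v).tendsto _).comp h

theorem sqrt_mem {x : VNElem M} (hx : 0 ≤ x) :
    CFC.sqrt (x : H →L[ℂ] H) ∈ M.toStarSubalgebra := by
  have hx' : 0 ≤ (x : H →L[ℂ] H) := hx
  refine mem_iff_forall_commute.2 fun y hy => ?_
  rw [CFC.sqrt_eq_real_sqrt _ hx']
  exact (IsSelfAdjoint.of_nonneg hx').commute_cfcₙ (mem_iff_forall_commute.1 x.2 y hy) _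

scoped instance starOrderedRing : StarOrderedRing (VNElem M) := by
  refine .of_nonneg_iff' (fun h z => add_le_add_right h z) fun x => ⟨fun hx => ?_, ?_⟩
  · have hsa : IsSelfAdjoint (CFC.sqrt (x : H →L[ℂ] H)) := .of_nonneg (CFC.sqrt_nonneg _)
    refine ⟨⟨_, sqrt_mem hx⟩, Subtype.ext ?_⟩
    exact ((congrArg (· * _) hsa.star_eq).trans (CFC.sqrt_mul_sqrt_self _ hx)).symm
  · rintro ⟨y, rfl⟩
    exact star_mul_self_nonneg (y : H →L[ℂ] H)

theorem isStarProjection_coe_iff {p : VNElem M} :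
    IsStarProjection (p : H →L[ℂ] H) ↔ IsStarProjection p := by
  simp only [isStarProjection_iff', Subtype.ext_iff]
  rfl

instance completeSpace_ker (b : VNElem M) : CompleteSpace (b : H →L[ℂ] H).ker :=
  (ContinuousLinearMap.isClosed_ker (b : H →L[ℂ] H)).completeSpace_coe

theorem starProjection_ker_mem (b : VNElem M) :
    (b : H →L[ℂ] H).ker.starProjection ∈ M.toStarSubalgebra := by
  refine (VonNeumannAlgebra.IsStarProjection.mem_iff isStarProjection_starProjection M).2
    fun y hy v hv => ?_
  rw [Submodule.range_starProjection] at hv ⊢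
  have hby : (b : H →L[ℂ] H) (y v) = y ((b : H →L[ℂ] H) v) :=
    DFunLike.congr_fun (mem_iff_forall_commute.1 b.2 y hy).eq v
  exact hby.trans ((congrArg y hv).trans (map_zero y))

/-- The projection onto the kernel of `b`, as an element of `M`; for `b ≥ 0` it is the complement
of the support of `b`. -/
noncomputable def kerProj (b : VNElem M) : VNElem M :=
  ⟨(b : H →L[ℂ] H).ker.starProjection, b.starProjection_ker_mem⟩

theorem isStarProjection_kerProj (b : VNElem M) : IsStarProjection b.kerProj :=
  isStarProjection_coe_iff.1 isStarProjection_starProjection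

theorem mul_kerProj (b : VNElem M) : b * b.kerProj = 0 :=
  Subtype.ext <| ContinuousLinearMap.ext fun v =>
    (b : H →L[ℂ] H).ker.starProjection_apply_mem v

theorem kerProj_mul_eq_self_iff {b x : VNElem M} : b.kerProj * x = x ↔ b * x = 0 := by
  refine ⟨fun h => by rw [← h, ← mul_assoc, b.mul_kerProj, zero_mul], fun h => ?_⟩
  refine Subtype.ext <| ContinuousLinearMap.ext fun v => Submodule.starProjection_eq_self_iff.2 ?_
  exact congrArg (fun T : VNElem M => (T : H →L[ℂ] H) v) h

theorem le_kerProj_iff {b p : VNElem M} (hp : IsStarProjection p) :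
    p ≤ b.kerProj ↔ b * p = 0 := by
  rw [hp.le_iff_mul_eq_right b.isStarProjection_kerProj, kerProj_mul_eq_self_iff]

end VNElem

section PowerMean

variable {A : Type*} [Ring A] [Algebra ℂ A] {b : A}

/-- The Cesàro mean of `1, t, …, tⁿ`, which approximates the projection onto the fixed vectors of a
contraction `t`. -/
noncomputable def powerMean (t : A) (n : ℕ) : A :=
  ((n + 1 : ℕ) : ℂ)⁻¹ • ∑ k ∈ Finset.range (n + 1), t ^ k

theorem one_sub_pow_mem {S : NonUnitalSubalgebra ℂ A} (hb : b ∈ S) (n : ℕ) :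
    1 - (1 - b) ^ n ∈ S := by
  induction n with
  | zero => simp
  | succ n ih =>
    have h : 1 - (1 - b) ^ (n + 1) = (1 - (1 - b) ^ n) + (b - (1 - (1 - b) ^ n) * b) := by
      rw [pow_succ]
      noncomm_ring
    rw [h]
    exact add_mem ih (sub_mem hb (mul_mem ih hb))

theorem one_sub_powerMean_mem {S : NonUnitalSubalgebra ℂ A} (hb : b ∈ S) (n : ℕ) :
    1 - powerMean (1 - b) n ∈ S := by
  have h : 1 - powerMean (1 - b) n
      = ((n + 1 : ℕ) : ℂ)⁻¹ • ∑ k ∈ Finset.range (n + 1), (1 - (1 - b) ^ k) := by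
    rw [Finset.sum_sub_distrib, smul_sub, Finset.sum_const, Finset.card_range,
      ← Nat.cast_smul_eq_nsmul ℂ, inv_smul_smul₀ (Nat.cast_ne_zero.2 n.succ_ne_zero), powerMean]
  rw [h]
  exact SMulMemClass.smul_mem _ (sum_mem fun k _ => one_sub_pow_mem hb k)

theorem norm_powerMean_le {A : Type*} [NormedRing A] [NormedAlgebra ℂ A] {t : A}
    (h1 : ‖(1 : A)‖ ≤ 1) (ht : ‖t‖ ≤ 1) (n : ℕ) : ‖powerMean t n‖ ≤ 1 := by
  have hpow (k : ℕ) : ‖t ^ k‖ ≤ 1 := by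
    rcases k.eq_zero_or_pos with rfl | hk
    · rwa [pow_zero]
    · exact (norm_pow_le' t hk).trans (pow_le_one₀ (norm_nonneg t) ht)
  have hsum : ‖∑ k ∈ Finset.range (n + 1), t ^ k‖ ≤ (n + 1 : ℕ) :=
    (norm_sum_le_of_le _ fun k _ => hpow k).trans_eq (by simp)
  rw [powerMean, norm_smul, norm_inv, Complex.norm_natCast]
  exact inv_mul_le_one_of_le₀ hsum (Nat.cast_nonneg _)

end PowerMean

section NullSubalgebra

variable {A : Type*} [Ring A] [Algebra ℂ A] [TopologicalSpace A] {φ : StrongDual ℂ A} {p : A}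

/-- The elements `a` with `φ(x a) = 0 = φ(a x)` for all `x`. A projection `p` satisfies
`φ(x p) = φ(x) = φ(p x)` for all `x` exactly when `1 - p` is one of them. -/
def nullSubalgebra (φ : StrongDual ℂ A) : NonUnitalSubalgebra ℂ A where
  carrier := {a | ∀ x, φ (x * a) = 0 ∧ φ (a * x) = 0}
  zero_mem' x := by simp
  add_mem' ha hb x := by
    rw [mul_add, add_mul, map_add, map_add, (ha x).1, (ha x).2, (hb x).1, (hb x).2, add_zero]
    exact ⟨rfl, rfl⟩
  mul_mem' {a b} ha hb x := by
    rw [← mul_assoc, mul_assoc a]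
    exact ⟨(hb (x * a)).1, (ha (b * x)).2⟩
  smul_mem' c a ha x := by
    rw [mul_smul_comm, smul_mul_assoc, map_smul, map_smul, (ha x).1, (ha x).2, smul_zero]
    exact ⟨rfl, rfl⟩

theorem one_sub_mem_nullSubalgebra_iff :
    1 - p ∈ nullSubalgebra φ ↔ ∀ x, φ (x * p) = φ x ∧ φ (p * x) = φ x := by
  refine forall_congr' fun x => ?_
  rw [mul_sub, sub_mul, mul_one, one_mul, map_sub, map_sub, sub_eq_zero, sub_eq_zero,
    @eq_comm _ (φ x), @eq_comm _ (φ x)]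

end NullSubalgebra

section NormalFunctional

open scoped VNElem

variable {H : Type*} [NormedAddCommGroup H] [InnerProductSpace ℂ H] [CompleteSpace H]
  {M : VonNeumannAlgebra H} {φ : StrongDual ℂ (VNElem M)}

theorem VNElem.tendsto_powerMean_apply {b : VNElem M} (hb : ‖1 - b‖ ≤ 1) (v : H) :
    Tendsto (fun n => ((powerMean (1 - b) n : VNElem M) : H →L[ℂ] H) v) atTop
      (𝓝 ((b.kerProj : H →L[ℂ] H) v)) := by
  set T : H →L[ℂ] H := (1 - b : VNElem M).1 with hT
  have hmean (n : ℕ) : ((powerMean (1 - b) n : VNElem M) : H →L[ℂ] H) v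
      = birkhoffAverage ℂ T id (n + 1) v := by
    simp [powerMean, birkhoffAverage, birkhoffSum, hT]
  have hfix : (T : H →ₗ[ℂ] H).eqLocus ((1 : H →L[ℂ] H) : H →ₗ[ℂ] H) = (b : H →L[ℂ] H).ker := by
    ext w
    simp [hT, LinearMap.mem_eqLocus]
  have hproj : (b.kerProj : H →L[ℂ] H) v
      = ((T : H →ₗ[ℂ] H).eqLocus ((1 : H →L[ℂ] H) : H →ₗ[ℂ] H)).starProjection v := by
    simp only [hfix, kerProj]
  simp only [hmean, hproj]
  exact (T.tendsto_birkhoffAverage_orthogonalProjection hb v).comp (tendsto_add_atTop_nat 1)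

theorem compress_apply (e f x : VNElem M) : compress e f φ x = φ (f * (x * e)) := rfl

theorem IsNormalFunctional.compress (hφ : IsNormalFunctional φ) (e f : VNElem M) :
    IsNormalFunctional (compress e f φ) := by
  have summable_apply : ∀ (T : H →L[ℂ] H) {ζ : ℕ → H}, (Summable fun n => ‖ζ n‖ ^ 2) →
      Summable fun n => ‖T (ζ n)‖ ^ 2 := fun T ζ hζ =>
    (hζ.mul_left (‖T‖ ^ 2)).of_nonneg_of_le (fun n => by positivity) fun n => by
      rw [← mul_pow]
      gcongr
      exact T.le_opNorm _
  obtain ⟨ξ, η, hξ, hη, hφ⟩ := hφ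
  refine ⟨fun n => (e : H →L[ℂ] H) (ξ n), fun n => (f : H →L[ℂ] H).adjoint (η n),
    summable_apply _ hξ, summable_apply _ hη, fun x => ?_⟩
  simp only [compress_apply, hφ, ContinuousLinearMap.adjoint_inner_left]
  rfl

theorem IsNormalFunctional.tendsto (hφ : IsNormalFunctional φ) {ι : Type*} {l : Filter ι}
    {T : ι → VNElem M} {S : VNElem M} {C : ℝ} (hC : ∀ i, ‖T i‖ ≤ C)
    (h : ∀ v : H, Tendsto (fun i => (T i : H →L[ℂ] H) v) l (𝓝 ((S : H →L[ℂ] H) v))) :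
    Tendsto (fun i => φ (T i)) l (𝓝 (φ S)) := by
  obtain ⟨ξ, η, hξ, hη, hφ⟩ := hφ
  simp only [hφ]
  refine tendsto_tsum_of_dominated_convergence
    (bound := fun n => |C| * (‖ξ n‖ ^ 2 + ‖η n‖ ^ 2)) ((hξ.add hη).mul_left _)
    (fun n => tendsto_const_nhds.inner (h (ξ n))) (Eventually.of_forall fun i n => ?_)
  calc ‖inner ℂ (η n) ((T i : H →L[ℂ] H) (ξ n))‖
      ≤ ‖η n‖ * ‖(T i : H →L[ℂ] H) (ξ n)‖ := norm_inner_le_norm _ _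
    _ ≤ ‖η n‖ * (|C| * ‖ξ n‖) := by
      gcongr
      exact (T i : H →L[ℂ] H).le_of_opNorm_le ((hC i).trans (le_abs_self C)) _
    _ = |C| * (‖ξ n‖ * ‖η n‖) := by ring
    _ ≤ |C| * (‖ξ n‖ ^ 2 + ‖η n‖ ^ 2) := by
      gcongr
      nlinarith [sq_nonneg (‖ξ n‖ - ‖η n‖), sq_nonneg (‖ξ n‖), sq_nonneg (‖η n‖)]

theorem IsNormalFunctional.mem_nullSubalgebra_of_tendsto (hφ : IsNormalFunctional φ) {ι : Type*}
    {l : Filter ι} [l.NeBot] {T : ι → VNElem M} {S : VNElem M} {C : ℝ} (hC : ∀ i, ‖T i‖ ≤ C)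
    (h : ∀ v : H, Tendsto (fun i => (T i : H →L[ℂ] H) v) l (𝓝 ((S : H →L[ℂ] H) v)))
    (hT : ∀ i, T i ∈ nullSubalgebra φ) : S ∈ nullSubalgebra φ := by
  intro x
  have hleft := (hφ.compress 1 x).tendsto hC h
  have hright := (hφ.compress x 1).tendsto hC h
  simp only [compress_apply, mul_one, one_mul, (hT _ x).1, (hT _ x).2] at hleft hright
  exact ⟨tendsto_nhds_unique hleft tendsto_const_nhds,
    tendsto_nhds_unique hright tendsto_const_nhds⟩

theorem IsNormalFunctional.one_sub_kerProj_mem_nullSubalgebra (hφ : IsNormalFunctional φ)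
    {a : VNElem M} (ha : 0 ≤ a) (h : a ∈ nullSubalgebra φ) : 1 - a.kerProj ∈ nullSubalgebra φ := by
  have hr : (0 : ℝ) < (‖a‖ + 1)⁻¹ := by positivity
  set b : VNElem M := (‖a‖ + 1)⁻¹ • a with hb
  have hb1 : ‖1 - b‖ ≤ 1 :=
    norm_one_sub_le_one (smul_nonneg hr.le ha) (inv_norm_add_one_smul_le_one ha)
  have hbφ : b ∈ nullSubalgebra φ := by
    rw [hb, ← Complex.coe_smul]
    exact SMulMemClass.smul_mem _ h
  have hker : b.kerProj = a.kerProj := by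
    have hab : ∀ x, b * x = 0 ↔ a * x = 0 := fun x => by
      rw [hb, smul_mul_assoc, smul_eq_zero_iff_right hr.ne']
    refine le_antisymm ?_ ?_
    · rw [VNElem.le_kerProj_iff b.isStarProjection_kerProj, ← hab, b.mul_kerProj]
    · rw [VNElem.le_kerProj_iff a.isStarProjection_kerProj, hab, a.mul_kerProj]
  have h1 : ‖(1 : VNElem M)‖ ≤ 1 := ContinuousLinearMap.norm_id_le
  rw [← hker]
  refine hφ.mem_nullSubalgebra_of_tendsto (C := 2) (fun n => ?_)
    (fun v => tendsto_const_nhds.sub (VNElem.tendsto_powerMean_apply hb1 v))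
    (one_sub_powerMean_mem hbφ)
  calc ‖(1 : VNElem M) - powerMean (1 - b) n‖ ≤ ‖(1 : VNElem M)‖ + ‖powerMean (1 - b) n‖ :=
        norm_sub_le _ _
    _ ≤ 1 + 1 := add_le_add h1 (norm_powerMean_le h1 hb1 n)
    _ = 2 := one_add_one_eq_two

end NormalFunctional

section Support

open scoped VNElem

variable {H : Type*} [NormedAddCommGroup H] [InnerProductSpace ℂ H] [CompleteSpace H]
  {M : VonNeumannAlgebra H}

theorem VNElem.le_one_sub_kerProj {b p : VNElem M} (hp : IsStarProjection p) (hpb : p ≤ b) :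
    p ≤ 1 - b.kerProj :=
  le_one_sub_of_mul_eq_zero b.isStarProjection_kerProj hp.isSelfAdjoint hp.le_one
    (mul_eq_zero_of_nonneg_of_le hp.nonneg hpb b.mul_kerProj)

theorem VNElem.exists_isStarProjection_tendsto_apply {ι : Type*} [Preorder ι] [Nonempty ι]
    [IsDirectedOrder ι] {p : ι → VNElem M} (hp : ∀ i, IsStarProjection (p i)) (hmono : Monotone p) :
    ∃ q : VNElem M, IsStarProjection q ∧ (∀ i, p i ≤ q) ∧
      ∀ v, Tendsto (fun i => (p i : H →L[ℂ] H) v) atTop (𝓝 ((q : H →L[ℂ] H) v)) := by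
  choose U hU hpU using fun i =>
    isStarProjection_iff_eq_starProjection.1 (isStarProjection_coe_iff.2 (hp i))
  have hUmono : Monotone U := fun i j hij => by
    rw [← Submodule.starProjection_le_starProjection_iff, ← hpU, ← hpU]
    exact hmono hij
  set W := (⨆ i, U i).topologicalClosure
  have : CompleteSpace W := (Submodule.isClosed_topologicalClosure _).completeSpace_coe
  have hlim : ∀ v, Tendsto (fun i => (p i : H →L[ℂ] H) v) atTop (𝓝 (W.starProjection v)) := by
    simp only [hpU]
    exact Submodule.starProjection_tendsto_closure_iSup U hUmono
  refine ⟨⟨W.starProjection, mem_of_tendsto_apply hlim⟩,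
    isStarProjection_coe_iff.1 isStarProjection_starProjection, fun i => ?_, hlim⟩
  change (p i : H →L[ℂ] H) ≤ W.starProjection
  rw [hpU, Submodule.starProjection_le_starProjection_iff]
  exact (le_iSup U i).trans (Submodule.le_topologicalClosure _)

variable {φ ρ : StrongDual ℂ (VNElem M)} {a e : VNElem M}

theorem IsNormalFunctional.isDirectedOrder_nullProjections (hφ : IsNormalFunctional φ) :
    IsDirectedOrder {z : VNElem M // IsStarProjection z ∧ z ∈ nullSubalgebra φ} where
  directed := by
    rintro ⟨z, hz, hzφ⟩ ⟨w, hw, hwφ⟩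
    refine ⟨⟨1 - (z + w).kerProj, (z + w).isStarProjection_kerProj.one_sub,
      hφ.one_sub_kerProj_mem_nullSubalgebra (add_nonneg hz.nonneg hw.nonneg) (add_mem hzφ hwφ)⟩,
      ?_, ?_⟩
    · exact VNElem.le_one_sub_kerProj hz (le_add_of_nonneg_right hw.nonneg)
    · exact VNElem.le_one_sub_kerProj hw (le_add_of_nonneg_left hz.nonneg)

theorem IsNormalFunctional.exists_isFunctionalSupport (hφ : IsNormalFunctional φ) :
    ∃ s, IsFunctionalSupport φ s := by
  have := hφ.isDirectedOrder_nullProjections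
  have : Nonempty {z : VNElem M // IsStarProjection z ∧ z ∈ nullSubalgebra φ} :=
    ⟨0, .zero _, zero_mem _⟩
  obtain ⟨q, hq, hle, hlim⟩ := VNElem.exists_isStarProjection_tendsto_apply
    (p := ((↑) : {z : VNElem M // IsStarProjection z ∧ z ∈ nullSubalgebra φ} → VNElem M))
    (fun z => z.2.1) (fun _ _ h => h)
  have hqφ : q ∈ nullSubalgebra φ :=
    hφ.mem_nullSubalgebra_of_tendsto (fun z => z.2.1.norm_le) hlim fun z => z.2.2
  refine ⟨1 - q, ⟨hq.one_sub, ?_⟩, fun p hp => ?_⟩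
  · rwa [← one_sub_mem_nullSubalgebra_iff, sub_sub_cancel]
  · exact sub_le_comm.1 (hle ⟨1 - p, hp.1.one_sub, one_sub_mem_nullSubalgebra_iff.2 hp.2⟩)

theorem IsFunctionalSupport.apply_conj (he : IsFunctionalSupport ρ e) (a : VNElem M) :
    ρ (e * a * e) = ρ a := by
  rw [(he.1.2 _).1, (he.1.2 _).2]

theorem IsFunctionalSupport.apply_eq_zero_of_mul_eq_zero (he : IsFunctionalSupport ρ e)
    (h : e * a = 0) : ρ a = 0 := by
  rw [← (he.1.2 a).2, h, map_zero]

theorem IsPositiveFunctional.mem_nullSubalgebra (hρ : IsPositiveFunctional ρ) (ha : 0 ≤ a)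
    (h : ρ a = 0) : a ∈ nullSubalgebra ρ := by
  refine map_mul_eq_zero_of_map_eq_zero (.mk₀ (ρ : VNElem M →ₗ[ℂ] ℂ) fun x hx => ?_) ha h
  obtain ⟨y, rfl⟩ := CStarAlgebra.nonneg_iff_eq_star_mul_self.1 hx
  exact hρ y

theorem IsFunctionalSupport.mul_eq_zero_of_apply_eq_zero (he : IsFunctionalSupport ρ e)
    (hρn : IsNormalFunctional ρ) (hρ : IsPositiveFunctional ρ) (ha : 0 ≤ a) (h : ρ a = 0) :
    a * e = 0 := by
  have hk : e ≤ a.kerProj := he.2 ⟨a.isStarProjection_kerProj, one_sub_mem_nullSubalgebra_iff.1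
    (hρn.one_sub_kerProj_mem_nullSubalgebra ha (hρ.mem_nullSubalgebra ha h))⟩
  exact (VNElem.le_kerProj_iff he.1.1).1 hk

end Support

section Trace

open scoped VNElem

variable {H : Type*} [NormedAddCommGroup H] [InnerProductSpace ℂ H] [CompleteSpace H]
  {M : VonNeumannAlgebra H} {τ : FNSTrace M} {b e p w x y : VNElem M}

theorem VNElem.exists_isStarProjection_mul_eq_posPart (hw : IsSelfAdjoint w) :
    ∃ p, IsStarProjection p ∧ p * w = w⁺ ∧ w * p = w⁺ := by
  have hk := VNElem.isStarProjection_kerProj w⁺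
  have hpos : (1 - VNElem.kerProj w⁺) * w⁺ = w⁺ := by
    rw [sub_mul, one_mul, sub_eq_self, mul_eq_zero_comm_of_isSelfAdjoint hk.isSelfAdjoint
      (.of_nonneg (CFC.posPart_nonneg w)), VNElem.mul_kerProj]
  have hneg : (1 - VNElem.kerProj w⁺) * w⁻ = 0 := by
    rw [sub_mul, one_mul, sub_eq_zero, eq_comm, VNElem.kerProj_mul_eq_self_iff,
      CFC.posPart_mul_negPart]
  have hleft : (1 - VNElem.kerProj w⁺) * w = w⁺ := by
    nth_rw 2 [← CFC.posPart_sub_negPart w hw]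
    rw [mul_sub, hpos, hneg, sub_zero]
  refine ⟨_, hk.one_sub, hleft, ?_⟩
  have h := congrArg star hleft
  rwa [star_mul, hw.star_eq, hk.one_sub.isSelfAdjoint.star_eq,
    (IsSelfAdjoint.of_nonneg (CFC.posPart_nonneg w)).star_eq] at h

theorem VNElem.exists_isStarProjection_smul_le {ε : ℝ} (hy : 0 ≤ y) (hε : 0 ≤ ε) (hεy : ε < ‖y‖) :
    ∃ p, IsStarProjection p ∧ p ≠ 0 ∧ ε • p ≤ y := by
  set w := y - algebraMap ℝ (VNElem M) ε with hw
  have hwsa : IsSelfAdjoint w := (IsSelfAdjoint.of_nonneg hy).sub (.algebraMap _ (.all ε))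
  obtain ⟨p, hp, hpw, hwp⟩ := exists_isStarProjection_mul_eq_posPart hwsa
  have hpy : p * y = w⁺ + ε • p := by
    rw [← hpw, hw, mul_sub, ← Algebra.commutes, ← Algebra.smul_def, sub_add_cancel]
  have hyp : y * p = w⁺ + ε • p := by
    rw [← hwp, hw, sub_mul, ← Algebra.smul_def, sub_add_cancel]
  refine ⟨p, hp, ?_, ?_⟩
  · rintro rfl
    have hw0 : w ≤ 0 := by
      rw [← CFC.posPart_sub_negPart w hwsa, ← hpw, zero_mul, zero_sub, neg_nonpos]
      exact CFC.negPart_nonneg w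
    exact hεy.not_ge ((CStarAlgebra.norm_le_iff_le_algebraMap y hε hy).2 (sub_nonpos.1 hw0))
  · have hcut : (1 - p) * y * (1 - p) = y - p * y := by
      have hcomm : Commute (1 - p) y := (Commute.one_left y).sub_left (hpy.trans hyp.symm)
      rw [hcomm.eq, mul_assoc, hp.one_sub.isIdempotentElem.eq, ← hcomm.eq, sub_mul, one_mul]
    calc ε • p ≤ w⁺ + ε • p := le_add_of_nonneg_left (CFC.posPart_nonneg w)
      _ = p * y := hpy.symm
      _ ≤ y := sub_nonneg.1 (hcut ▸ hp.one_sub.isSelfAdjoint.conjugate_nonneg hy)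

theorem FNSTrace.mono (hx : 0 ≤ x) (hxy : x ≤ y) : τ.toFun x ≤ τ.toFun y := by
  have h := τ.map_add x (y - x) hx (sub_nonneg.2 hxy)
  rw [add_sub_cancel] at h
  exact h ▸ le_self_add

theorem FNSTrace.toFun_smul {c : ℝ} (hc : 0 ≤ c) (hx : 0 ≤ x) :
    τ.toFun (c • x) = ENNReal.ofReal c * τ.toFun x := by
  rw [← Complex.coe_smul, ENNReal.ofReal_eq_coe_nnreal hc]
  exact τ.map_smul ⟨c, hc⟩ x hx

theorem FNSTrace.toFun_zero : τ.toFun 0 = 0 := by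
  simpa using τ.toFun_smul le_rfl (le_refl (0 : VNElem M))

theorem FNSTrace.toFun_conj_lt_top (hp : IsStarProjection p) (hτ : τ.toFun p < ∞) (hx : 0 ≤ x) :
    τ.toFun (p * x * p) < ∞ := by
  have hle : p * x * p ≤ ‖x‖ • p := by
    simpa only [hp.isSelfAdjoint.star_eq, hp.isIdempotentElem.eq] using
      CStarAlgebra.star_left_conjugate_le_norm_smul (a := p) (.of_nonneg hx)
  refine (τ.mono (hp.isSelfAdjoint.conjugate_nonneg hx) hle).trans_lt ?_
  rw [τ.toFun_smul (norm_nonneg x) hp.nonneg]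
  exact ENNReal.mul_lt_top ENNReal.ofReal_lt_top hτ

theorem FNSTrace.exists_isTraceFunctional (hp : IsStarProjection p) (hτ : τ.toFun p < ∞) :
    ∃ φ, IsTraceFunctional τ p φ := by
  have hnonneg : ∀ {x : VNElem M}, 0 ≤ x → 0 ≤ p * x * p := hp.isSelfAdjoint.conjugate_nonneg
  obtain ⟨φ, hφ⟩ := exists_positiveLinearMap_of_additive
    (f := fun x : VNElem M => (τ.toFun (p * x * p)).toReal) (fun _ _ => ENNReal.toReal_nonneg)
    (fun x y hx hy => by
      rw [mul_add, add_mul, τ.map_add _ _ (hnonneg hx) (hnonneg hy),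
        ENNReal.toReal_add (τ.toFun_conj_lt_top hp hτ hx).ne (τ.toFun_conj_lt_top hp hτ hy).ne])
    (fun c x hc hx => by
      rw [mul_smul_comm, smul_mul_assoc, τ.toFun_smul hc (hnonneg hx), ENNReal.toReal_mul,
        ENNReal.toReal_ofReal hc])
  exact ⟨⟨φ.toLinearMap, map_continuous φ⟩, hφ⟩

theorem IsTraceFunctional.conj_eq_zero_of_apply_eq_zero {φ : StrongDual ℂ (VNElem M)}
    (hφ : IsTraceFunctional τ p φ) (hp : IsStarProjection p) (hτ : τ.toFun p < ∞) (hx : 0 ≤ x)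
    (h : φ x = 0) : p * x * p = 0 := by
  have htrace := (hφ x hx).symm.trans h
  rw [Complex.ofReal_eq_zero, ENNReal.toReal_eq_zero_iff] at htrace
  exact τ.faithful _ (hp.isSelfAdjoint.conjugate_nonneg hx)
    (htrace.resolve_right (τ.toFun_conj_lt_top hp hτ hx).ne)

theorem FNSTrace.exists_finite_isStarProjection_smul_le (hx : 0 ≤ x) (hx0 : x ≠ 0) :
    ∃ (p : VNElem M) (ε : ℝ), IsStarProjection p ∧ p ≠ 0 ∧ τ.toFun p < ∞ ∧ 0 < ε ∧ ε • p ≤ x := by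
  obtain ⟨y, hy, hyx, hy0, hyτ⟩ := τ.semifinite x hx hx0
  have hε : 0 < ‖y‖ / 2 := half_pos (norm_pos_iff.2 hy0)
  obtain ⟨p, hp, hp0, hpy⟩ :=
    VNElem.exists_isStarProjection_smul_le hy hε.le (half_lt_self (norm_pos_iff.2 hy0))
  refine ⟨p, _, hp, hp0, ?_, hε, hpy.trans hyx⟩
  have hlt := (τ.mono (smul_nonneg hε.le hp.nonneg) hpy).trans_lt hyτ
  rw [τ.toFun_smul hε.le hp.nonneg] at hlt
  exact ENNReal.lt_top_of_mul_ne_top_right hlt.ne (ENNReal.ofReal_pos.2 hε).ne'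

theorem FNSTrace.conj_eq_zero_of_forall_finite (τ : FNSTrace M) (hb : 0 ≤ b)
    (he : IsStarProjection e)
    (h : ∀ p, IsStarProjection p → p ≤ e → τ.toFun p < ∞ → p * b * p = 0) : e * b * e = 0 := by
  by_contra hne
  have hebe : 0 ≤ e * b * e := he.isSelfAdjoint.conjugate_nonneg hb
  obtain ⟨p, ε, hp, hp0, hpτ, hε, hple⟩ := τ.exists_finite_isStarProjection_smul_le hebe hne
  have hann : ∀ {c}, e * b * e * c = 0 → p * c = 0 := fun {c} hc => by
    have := mul_eq_zero_of_nonneg_of_le (smul_nonneg hε.le hp.nonneg) hple hc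
    rwa [smul_mul_assoc, smul_eq_zero_iff_right hε.ne'] at this
  have hpe : p * e = p := by
    have : p * (1 - e) = 0 := hann (by rw [mul_assoc, he.mul_one_sub_self, mul_zero])
    rwa [mul_sub, mul_one, sub_eq_zero, eq_comm] at this
  have hle : p ≤ e := hp.le_of_mul_eq_left he hpe
  have hbp : b * p = 0 := (star_mul_mul_eq_zero_iff hb).1 <| by
    rw [hp.isSelfAdjoint.star_eq, h p hp hle hpτ]
  refine hp0 (hp.isIdempotentElem.eq.symm.trans (hann ?_))
  rw [mul_assoc, (hp.le_iff_mul_eq_right he).1 hle, mul_assoc, hbp, mul_zero]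

end Trace

section PositiveMap

open scoped VNElem

variable {H : Type*} [NormedAddCommGroup H] [InnerProductSpace ℂ H] [CompleteSpace H]
  {M : VonNeumannAlgebra H} {τ : FNSTrace M} {T : VNElem M →L[ℂ] VNElem M}
  {ρ X ψ : StrongDual ℂ (VNElem M)} {e p q t : VNElem M}

theorem map_le_one_of_le_one (hT : ∀ x, 0 ≤ x → 0 ≤ T x) (hT1 : T 1 ≤ 1) (hp : p ≤ 1) :
    T p ≤ 1 := by
  have h := hT _ (sub_nonneg.2 hp)
  rw [map_sub, sub_nonneg] at h
  exact h.trans hT1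

theorem IsFunctionalSupport.map_one_sub_mul_eq_zero (he : IsFunctionalSupport ρ e)
    (hT : ∀ x, 0 ≤ x → 0 ≤ T x) (hρn : IsNormalFunctional ρ) (hρ : IsPositiveFunctional ρ)
    (hinv : ∀ x, ρ (T x) = ρ x) : T (1 - e) * e = 0 := by
  refine he.mul_eq_zero_of_apply_eq_zero hρn hρ (hT _ he.1.1.one_sub.nonneg) ?_
  rw [hinv]
  exact he.apply_eq_zero_of_mul_eq_zero he.1.1.mul_one_sub_self

theorem mem_nullSubalgebra_dualMap_compress (hT : ∀ x, 0 ≤ x → 0 ≤ T x) (he : IsSelfAdjoint e)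
    (hp : 0 ≤ p) (h : e * (T p * e) = 0) :
    p ∈ nullSubalgebra (dualMap T (compress e e X)) := by
  let corner : VNElem M →ₚ[ℂ] VNElem M :=
    .mk₀ (LinearMap.mulLeft ℂ e ∘ₗ LinearMap.mulRight ℂ e ∘ₗ (T : VNElem M →ₗ[ℂ] VNElem M))
      fun x hx => (mul_assoc e (T x) e).subst (he.conjugate_nonneg (hT x hx))
  intro x
  obtain ⟨hxp, hpx⟩ := map_mul_eq_zero_of_map_eq_zero corner hp h x
  exact ⟨(congrArg X hxp).trans (map_zero X), (congrArg X hpx).trans (map_zero X)⟩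

theorem exists_isFunctionalSupport_dualMap_compress_le (hT : ∀ x, 0 ≤ x → 0 ≤ T x)
    (hTn : IsNormalFunctional ((compress e e X).comp T)) (he : IsStarProjection e)
    (h : T (1 - e) * e = 0) :
    ∃ s, IsFunctionalSupport (dualMap T (compress e e X)) s ∧ s ≤ e := by
  obtain ⟨s, hs⟩ := IsNormalFunctional.exists_isFunctionalSupport hTn
  refine ⟨s, hs, hs.2 ⟨he, one_sub_mem_nullSubalgebra_iff.1 ?_⟩⟩
  exact mem_nullSubalgebra_dualMap_compress hT he.isSelfAdjoint he.one_sub.nonneg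
    (by rw [h, mul_zero])

theorem IsLamperti.exists_isFunctionalSupport
    {γ : StrongDual ℂ (VNElem M) →ₗ[ℂ] StrongDual ℂ (VNElem M)} (hγ : IsLamperti τ γ)
    (hq : IsStarProjection q) (hqτ : τ.toFun q < ∞) (hψ : IsTraceFunctional τ q ψ) :
    ∃ t, IsFunctionalSupport (γ ψ) t := by
  have h0 : τ.toFun 0 < ∞ := by simp only [τ.toFun_zero, ENNReal.zero_lt_top]
  obtain ⟨φ, hφ⟩ := τ.exists_isTraceFunctional (.zero _) h0
  obtain ⟨_, t, _, ht, _⟩ := hγ 0 q (.zero _) hq h0 hqτ (zero_mul q) φ ψ hφ hψ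
  exact ⟨t, ht⟩

theorem IsLamperti.conj_map_eq_zero (hL : IsLamperti τ (dualMap T)) (hT : ∀ x, 0 ≤ x → 0 ≤ T x)
    (hq : IsStarProjection q) (hqτ : τ.toFun q < ∞) (hψ : IsTraceFunctional τ q ψ)
    (ht : IsFunctionalSupport (dualMap T ψ) t) (he : IsStarProjection e) (heq : e * q = 0) :
    e * T t * e = 0 := by
  have hTt : 0 ≤ T t := hT t ht.1.1.nonneg
  refine τ.conj_eq_zero_of_forall_finite hTt he fun p hp hpe hpτ => ?_
  have hpq : p * q = 0 := mul_eq_zero_of_nonneg_of_le hp.nonneg hpe heq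
  obtain ⟨φ, hφ⟩ := τ.exists_isTraceFunctional hp hpτ
  obtain ⟨s, t', hs, ht', hst⟩ := hL p q hp hq hpτ hqτ hpq φ ψ hφ hψ
  obtain rfl : t' = t := ht'.unique ht
  exact hφ.conj_eq_zero_of_apply_eq_zero hp hpτ hTt (hs.apply_eq_zero_of_mul_eq_zero hst)

theorem IsLamperti.map_mul_one_sub_eq_zero (hL : IsLamperti τ (dualMap T))
    (hT : ∀ x, 0 ≤ x → 0 ≤ T x) (hρn : IsNormalFunctional ρ) (hρ : IsPositiveFunctional ρ)
    (hinv : ∀ x, ρ (T x) = ρ x) (he : IsFunctionalSupport ρ e) : T e * (1 - e) = 0 := by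
  have heproj := he.1.1
  have hTe : 0 ≤ T e := hT e heproj.nonneg
  rw [← star_mul_mul_eq_zero_iff hTe, heproj.one_sub.isSelfAdjoint.star_eq]
  refine τ.conj_eq_zero_of_forall_finite hTe heproj.one_sub fun q hq hqle hqτ => ?_
  have hqe : q * e = 0 := mul_eq_zero_of_nonneg_of_le hq.nonneg hqle heproj.one_sub_mul_self
  have heq : e * q = 0 :=
    (mul_eq_zero_comm_of_isSelfAdjoint hq.isSelfAdjoint heproj.isSelfAdjoint).1 hqe
  obtain ⟨ψ, hψ⟩ := τ.exists_isTraceFunctional hq hqτ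
  obtain ⟨t, ht⟩ := hL.exists_isFunctionalSupport hq hqτ hψ
  have hcorner : e * T t * e = 0 := hL.conj_map_eq_zero hT hq hqτ hψ ht heproj heq
  have hρt : ρ t = 0 := by rw [← hinv, ← he.apply_conj, hcorner, map_zero]
  have hte : t * e = 0 := he.mul_eq_zero_of_apply_eq_zero hρn hρ ht.1.1.nonneg hρt
  exact hψ.conj_eq_zero_of_apply_eq_zero hq hqτ hTe (ht.apply_eq_zero_of_mul_eq_zero hte)

theorem proposition3p12_general {H : Type*} [NormedAddCommGroup H] [InnerProductSpace ℂ H]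
    [CompleteSpace H] {M : VonNeumannAlgebra H} (τ : FNSTrace M) {T : VNElem M →L[ℂ] VNElem M}
    (hT : ∀ x, 0 ≤ x → 0 ≤ T x) (hT1 : T 1 ≤ 1)
    (hTn : ∀ φ, IsNormalFunctional φ → IsNormalFunctional (φ.comp T))
    {ρ : StrongDual ℂ (VNElem M)} (hρn : IsNormalFunctional ρ) (hρ : IsPositiveFunctional ρ)
    (hinv : ∀ x, ρ (T x) = ρ x) {e : VNElem M} (he : IsFunctionalSupport ρ e) :
    T (1 - e) ≤ 1 - e ∧
    (∀ X, IsNormalFunctional X →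
      ∃ s, IsFunctionalSupport (dualMap T (compress e e X)) s ∧ s ≤ e) ∧
    (IsLamperti τ (dualMap T) → T e ≤ e) := by
  have heproj : IsStarProjection e := he.1.1
  have hTe : T (1 - e) * e = 0 := he.map_one_sub_mul_eq_zero hT hρn hρ hinv
  refine ⟨?_, fun X hX => ?_, fun hL => ?_⟩
  · exact le_one_sub_of_mul_eq_zero heproj (.of_nonneg (hT _ heproj.one_sub.nonneg))
      (map_le_one_of_le_one hT hT1 heproj.one_sub.le_one) hTe
  · exact exists_isFunctionalSupport_dualMap_compress_le hT (hTn _ (hX.compress e e)) heproj hTe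
  · have h := le_one_sub_of_mul_eq_zero heproj.one_sub (.of_nonneg (hT _ heproj.nonneg))
      (map_le_one_of_le_one hT hT1 heproj.le_one)
      (hL.map_mul_one_sub_eq_zero hT hρn hρ hinv he)
    rwa [sub_sub_cancel] at h

end PositiveMap

theorem proposition3p12
    {H : Type*} [NormedAddCommGroup H] [InnerProductSpace ℂ H] [CompleteSpace H]
    [TopologicalSpace.SeparableSpace H]
    (M : VonNeumannAlgebra H) (τ : FNSTrace M)
    {G : Type*} [Semigroup G] [TopologicalSpace G] [ContinuousMul G] [LocallyCompactSpace G]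
    [SecondCountableTopology G] [T2Space G] [MeasurableSpace G] [BorelSpace G]
    (m : Measure G) [SigmaFinite m] (hm : IsTwoSidedInvariant m)
    (K : ℕ → Set G) (hK : IsFolnerSequence m K)
    (α : G → VNElem M →L[ℂ] VNElem M) (hα : IsNCDynamicalSystem α)
    (e₁ e₂ : VNElem M) (he : IsNeveuDecomposition m K α e₁ e₂) :
    (∀ g, α g e₂ ≤ e₂) ∧
    (∀ (X : StrongDual ℂ (VNElem M)), IsNormalFunctional X → ∀ g,
      ∃ s : VNElem M, IsFunctionalSupport (dualMap (α g) (compress e₁ e₁ X)) s ∧ s ≤ e₁) ∧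
    ((∀ g, dualMap (α g) ∈ lampertiClass τ) → ∀ g, α g e₁ ≤ e₁) := by
  obtain ⟨ρ, hρn, hρ, hinv, hρe⟩ := he.exists_invariant
  obtain rfl : e₂ = 1 - e₁ := eq_sub_of_add_eq' he.add_eq_one
  have main g := proposition3p12_general τ (hα.positive g) (hα.map_one_le g) (hα.normal g)
    hρn hρ (hinv g) hρe
  exact ⟨fun g => (main g).1, fun X hX g => (main g).2.1 X hX,
    fun hL g => (main g).2.2 (hL g).2.2.2⟩
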